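/- Let $\sigma>0$, $A>0$, and let $h$ be a real random variable with $\mathbb{E}h^4<\infty$ and $\mathbb{E}h\neq 0$. Consider the fast fading channel $\mathcal{G}_{fast}$, $y_t=h_tx_t+z_t$ ($1\le t\le n$), where the $h_t$ are i.i.d. copies of $h$, the $z_t$ are i.i.d. $N(0,\sigma^2)$, and $(h_t)$ and $(z_t)$ are independent. An $(M,n,\lambda_1,\lambda_2)$ deterministic identification (DI) code for $\mathcal{G}_{fast}$ without side information, under the input constraint $A$, consists of codewords $\mathbf{u}_1,\dots,\mathbf{u}_M\in\mathbb{R}^n$ with $\|\mathbf{u}_i\|_2^2\le nA$ and measurable, possibly overlapping decoding regions $D_1,\dots,D_M\subset\mathbb{R}^n$ (which do not depend on the fading coefficients) such that, for all $i\neq j$ in $\{1,\dots,M\}$ (for all $i$ in the first line), \[ \int_{\mathbb{R}^n}\int_{D_i^c} f_{\mathbf z}(\mathbf{y}-\mathrm{diag}(\mathbf{h})\mathbf{u}_i)\,d\mathbf{y}\,dP_{\mathbf h}\le\lambda_1, \] \[ \int_{\mathbb{R}^n}\int_{D_j} f_{\mathbf z}(\mathbf{y}-\mathrm{diag}(\mathbf{h})\mathbf{u}_i)\,d\mathbf{y}\,dP_{\mathbf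 h}\le\lambda_2, \] where $f_{\mathbf z}(\mathbf z)=(2\pi\sigma^2)^{-n/2}e^{-\|\mathbf z\|_2^2/(2\sigma^2)}$ and $P_{\mathbf h}$ is the law of $\mathbf{h}=(h_1,\dots,h_n)$. A rate $R>0$ is achievable if for all $\lambda_1,\lambda_2>0$ there is $n_0$ such that for every $n\ge n_0$ there exists a $(\lceil n^{nR}\rceil,n,\lambda_1,\lambda_2)$ DI code. Let $C_{DI}(\mathcal{G}_{fast})\in[0,\infty]$ be the supremum of the achievable rates. Then \[ C_{DI}(\mathcal{G}_{fast})\ge \tfrac14 . \] -/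

import Mathlib

open MeasureTheory
open scoped ENNReal

noncomputable section

namespace FastFading

/-- The density of the noise vector `(z₁, …, zₙ)` with i.i.d. entries `N(0, σ²)`:
`f(z) = (2πσ²)^(-n/2) · exp(-‖z‖₂² / (2σ²))`. -/
def noiseDensity (σ : ℝ) {n : ℕ} (z : Fin n → ℝ) : ℝ :=
  1 / (2 * Real.pi * σ ^ 2) ^ ((n : ℝ) / 2) * Real.exp (-(∑ t, z t ^ 2) / (2 * σ ^ 2))

/-- The probability that the output `y_t = h_t x_t + z_t` lies in `D` when `x` is sent and the
fading coefficients `h_t` are i.i.d. with law `μ`: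
`∫ ∫_D f(y - diag(h) x) dy dP_𝐡`, where `P_𝐡` is the `n`-fold product of `μ`. -/
def outputProb (μ : Measure ℝ) (σ : ℝ) {n : ℕ} (x : Fin n → ℝ) (D : Set (Fin n → ℝ)) : ℝ≥0∞ :=
  ∫⁻ h : Fin n → ℝ, (∫⁻ y in D, ENNReal.ofReal (noiseDensity σ (fun t => y t - h t * x t)))
    ∂(Measure.pi fun _ : Fin n => μ)

/-- An `(M, n)` deterministic identification (DI) code without side information under the input
constraint `A`: `M` codewords in `ℝⁿ` with `‖u_i‖₂² ≤ n A`, and `M` (measurable, possibly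
overlapping) decoding regions, which do not depend on the fading coefficients. -/
structure DICode (A : ℝ) (M n : ℕ) where
  codeword : Fin M → Fin n → ℝ
  region : Fin M → Set (Fin n → ℝ)
  power_le : ∀ i, ∑ t, codeword i t ^ 2 ≤ n * A
  measurableSet_region : ∀ i, MeasurableSet (region i)

variable {A : ℝ} {M n : ℕ}

/-- Error of the first type: identity `i` is sent and receiver `i` rejects. -/
def DICode.errorOne (c : DICode A M n) (μ : Measure ℝ) (σ : ℝ) (i : Fin M) : ℝ≥0∞ :=
  outputProb μ σ (c.codeword i) (c.region i)ᶜ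

/-- Error of the second type: identity `i` is sent and receiver `j` accepts. -/
def DICode.errorTwo (c : DICode A M n) (μ : Measure ℝ) (σ : ℝ) (i j : Fin M) : ℝ≥0∞ :=
  outputProb μ σ (c.codeword i) (c.region j)

/-- `c` is an `(M, n, l₁, l₂)` DI code for the fast fading channel. -/
def DICode.HasErrorsLE (c : DICode A M n) (μ : Measure ℝ) (σ l₁ l₂ : ℝ) : Prop :=
  (∀ i, c.errorOne μ σ i ≤ ENNReal.ofReal l₁) ∧
    ∀ i j, i ≠ j → c.errorTwo μ σ i j ≤ ENNReal.ofReal l₂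

/-- `R > 0` is achievable if for all `l₁, l₂ > 0` and all sufficiently large `n` there is an
`(n^(nR), n, l₁, l₂)` DI code, where `n^(nR)` is rounded up if it is not an integer. -/
def IsAchievable (μ : Measure ℝ) (σ A R : ℝ) : Prop :=
  0 < R ∧ ∀ l₁ l₂ : ℝ, 0 < l₁ → 0 < l₂ → ∃ n₀ : ℕ, ∀ n : ℕ, n₀ ≤ n →
    ∃ c : DICode A ⌈(n : ℝ) ^ ((n : ℝ) * R)⌉₊ n, c.HasErrorsLE μ σ l₁ l₂

/-- The DI capacity of the fast fading channel without side information: the supremum, in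
`[0, ∞]`, of the achievable rates. -/
def capacityDI (μ : Measure ℝ) (σ A : ℝ) : ℝ≥0∞ :=
  ⨆ (R : ℝ) (_ : IsAchievable μ σ A R), ENNReal.ofReal R

end FastFading

end

open MeasureTheory ProbabilityTheory Filter Topology
open scoped ENNReal NNReal

/-! Write `a` for the mean of the fading law. Receiver `j` correlates `y` with its own codeword
`u_j` and accepts when the result is within `τ` of `a‖u_j‖²`. When `u_i` is sent, the correlation
has mean `a⟨u_j, u_i⟩` and, for entries bounded by `√A`, variance `O(n)`. Among codewords of equal
norm, `‖u_j‖² - ⟨u_j, u_i⟩ = ‖u_i - u_j‖² / 2`, so since `a ≠ 0` Chebyshev separates the identities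
once squared distances dominate `√n`.

Codewords lie on a grid with `K = ⌊n^γ⌋` levels and step `√A / K`. Hamming distance above `εn` gives
squared distance of order `n^(1 - 2γ)`, which dominates `√n` exactly when `γ < 1/4`. A
Gilbert–Varshamov argument (`exists_code_subset`) and pigeonhole on the norm
(`exists_code_const_norm`) leave about `n^(γ(1 - ε)n)` words, up to factors exponential in `n`. Thus
every `R < γ` is reached for small `ε`. `exists_DICode` joins code and decoder, and `code_size_le`
does the counting. -/

namespace FastFading

/-! ### Output law and concentration of linear statistics -/

/-- The variance `σ²` as a nonnegative real. -/
def noiseVar (σ : ℝ) : ℝ≥0 := ⟨σ ^ 2, sq_nonneg σ⟩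

lemma noiseDensity_eq_prod (σ : ℝ) {n : ℕ} (z : Fin n → ℝ) :
    noiseDensity σ z = ∏ t, gaussianPDFReal 0 (noiseVar σ) (z t) := by
  have hv : ((noiseVar σ : ℝ≥0) : ℝ) = σ ^ 2 := rfl
  have h0 : 0 ≤ 2 * Real.pi * σ ^ 2 := by positivity
  simp only [gaussianPDFReal, hv, sub_zero, Finset.prod_mul_distrib, Finset.prod_const,
    Finset.card_univ, Fintype.card_fin, ← Real.exp_sum, noiseDensity]
  congr 1
  · rw [inv_pow, one_div, Real.sqrt_eq_rpow, ← Real.rpow_mul_natCast h0]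
    congr 2; ring
  · rw [← Finset.sum_div, Finset.sum_neg_distrib]

lemma measurable_noiseDensity (σ : ℝ) {n : ℕ} :
    Measurable (noiseDensity σ : (Fin n → ℝ) → ℝ) := by
  unfold noiseDensity
  fun_prop

/-- A product measure is determined by its values on boxes, where the integral of the product
density factors. -/
lemma withDensity_noiseDensity {σ : ℝ} (hσ : 0 < σ) (n : ℕ) :
    (volume : Measure (Fin n → ℝ)).withDensity (fun z => ENNReal.ofReal (noiseDensity σ z)) =
      Measure.pi fun _ : Fin n => gaussianReal 0 (noiseVar σ) := by
  have hv : noiseVar σ ≠ 0 := by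
    intro h
    have : σ ^ 2 = 0 := congrArg NNReal.toReal h
    exact hσ.ne' (by simpa using this)
  symm
  refine Measure.pi_eq fun s hs => ?_
  rw [withDensity_apply _ (MeasurableSet.univ_pi hs), volume_pi, Measure.restrict_pi_pi,
    ← ofReal_integral_eq_lintegral_ofReal]
  · simp_rw [noiseDensity_eq_prod]
    rw [integral_fintype_prod_eq_prod (fun _ => gaussianPDFReal 0 (noiseVar σ)),
      ENNReal.ofReal_prod_of_nonneg]
    · exact Finset.prod_congr rfl fun i _ => (gaussianReal_apply_eq_integral 0 hv (s i)).symm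
    · exact fun i _ => integral_nonneg fun x => gaussianPDFReal_nonneg _ _ _
  · rw [show (noiseDensity σ : (Fin n → ℝ) → ℝ) = fun z =>
      ∏ t, gaussianPDFReal 0 (noiseVar σ) (z t) from funext (noiseDensity_eq_prod σ)]
    exact Integrable.fintype_prod fun i => (integrable_gaussianPDFReal 0 (noiseVar σ)).restrict
  · refine ae_of_all _ fun z => ?_
    simp only [Pi.zero_apply, noiseDensity_eq_prod]
    exact Finset.prod_nonneg fun i _ => gaussianPDFReal_nonneg _ _ _

/-- The output law is the law of `h x + z` under the product of the fading and noise laws. -/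
lemma outputProb_eq_prod (μ : Measure ℝ) [IsProbabilityMeasure μ] {σ : ℝ} (hσ : 0 < σ) {n : ℕ}
    (x : Fin n → ℝ) {D : Set (Fin n → ℝ)} (hD : MeasurableSet D) :
    outputProb μ σ x D =
      ((Measure.pi fun _ : Fin n => μ).prod
        (Measure.pi fun _ : Fin n => gaussianReal 0 (noiseVar σ)))
        {p | (fun t => p.2 t + p.1 t * x t) ∈ D} := by
  have hm : MeasurableSet {p : (Fin n → ℝ) × (Fin n → ℝ) |
      (fun t => p.2 t + p.1 t * x t) ∈ D} := by
    refine measurableSet_preimage ?_ hD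
    fun_prop
  rw [Measure.prod_apply hm, outputProb]
  refine lintegral_congr fun h => ?_
  have hm' : MeasurableSet (Prod.mk h ⁻¹' {p : (Fin n → ℝ) × (Fin n → ℝ) |
      (fun t => p.2 t + p.1 t * x t) ∈ D}) := measurable_prodMk_left hm
  -- For fixed `h`, translation invariance of Lebesgue measure allows the substitution `y = z + h
  -- x`.
  rw [← withDensity_noiseDensity hσ, withDensity_apply _ hm', ← lintegral_indicator hD,
    ← lintegral_indicator hm',
    ← lintegral_add_right_eq_self _ (fun t => h t * x t)]
  refine lintegral_congr fun z => ?_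
  simp only [Set.indicator, Set.mem_preimage, Set.mem_ofPred_eq, Pi.add_apply, add_sub_cancel_right]
  rfl

/-- Chebyshev's inequality for a weighted sum of i.i.d. variables. -/
lemma pi_weighted_sum_chebyshev (ν : Measure ℝ) [IsProbabilityMeasure ν] (hν : MemLp id 2 ν)
    {n : ℕ} (c : Fin n → ℝ) {s : ℝ} (hs : 0 < s) :
    (Measure.pi fun _ : Fin n => ν) {w | s ≤ |∑ t, c t * w t - (∫ x, x ∂ν) * ∑ t, c t|} ≤
      ENNReal.ofReal ((∑ t, c t ^ 2) * Var[id; ν] / s ^ 2) := by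
  have hc : ∀ t : Fin n, MemLp (fun x : ℝ => c t * x) 2 ν := fun t => hν.const_mul (c t)
  have hc' : ∀ t : Fin n, MemLp (fun w : Fin n → ℝ => c t * w t) 2 (Measure.pi fun _ => ν) :=
    fun t => (hc t).comp_measurePreserving (measurePreserving_eval (fun _ : Fin n => ν) t)
  have hL : MemLp (∑ t, fun w : Fin n → ℝ => c t * w t) 2 (Measure.pi fun _ => ν) :=
    memLp_finsetSum' _ fun t _ => hc' t
  have hvar : Var[∑ t, fun w : Fin n → ℝ => c t * w t; Measure.pi fun _ => ν] =
      (∑ t, c t ^ 2) * Var[id; ν] := by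
    rw [variance_sum_pi (X := fun t x => c t * x) hc, Finset.sum_mul]
    exact Finset.sum_congr rfl fun t _ => variance_const_mul (c t) id ν
  have hmean : ∫ w, (∑ t, fun w : Fin n → ℝ => c t * w t) w ∂(Measure.pi fun _ => ν) =
      (∫ x, x ∂ν) * ∑ t, c t := by
    simp only [Finset.sum_apply]
    rw [integral_finsetSum _ fun t _ => (hc' t).integrable (by norm_num), Finset.mul_sum]
    refine Finset.sum_congr rfl fun t _ => ?_
    rw [integral_const_mul,
      integral_comp_eval (μ := fun _ : Fin n => ν) (i := t) (f := fun x : ℝ => x)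
        hν.aestronglyMeasurable, mul_comm]
  have := meas_ge_le_variance_div_sq hL hs
  rw [hvar, hmean] at this
  simpa only [Finset.sum_apply] using this

/-- Concentration of a linear statistic of the channel output. -/
lemma outputProb_linear_chebyshev (μ : Measure ℝ) [IsProbabilityMeasure μ] (hμ : MemLp id 2 μ)
    {σ : ℝ} (hσ : 0 < σ) {n : ℕ} (x u : Fin n → ℝ) {τ : ℝ} (hτ : 0 < τ) :
    outputProb μ σ x {y | τ ≤ |∑ t, u t * y t - (∫ a, a ∂μ) * ∑ t, u t * x t|} ≤
      ENNReal.ofReal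
        (4 * ((∑ t, (u t * x t) ^ 2) * Var[id; μ] + (∑ t, u t ^ 2) * σ ^ 2) / τ ^ 2) := by
  have hD : MeasurableSet
      {y : Fin n → ℝ | τ ≤ |∑ t, u t * y t - (∫ a, a ∂μ) * ∑ t, u t * x t|} :=
    measurableSet_le measurable_const (by fun_prop)
  rw [outputProb_eq_prod μ hσ x hD]
  set P := Measure.pi fun _ : Fin n => μ
  set Q := Measure.pi fun _ : Fin n => gaussianReal 0 (noiseVar σ)
  -- A deviation of `τ` forces one of `τ / 2` in the fading part (`B`) or in the noise part (`C`);
  -- the halving produces the factor 4.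
  set B := {w : Fin n → ℝ | τ / 2 ≤
    |∑ t, (u t * x t) * w t - (∫ a, a ∂μ) * ∑ t, u t * x t|}
  set C := {w : Fin n → ℝ | τ / 2 ≤
    |∑ t, u t * w t - (∫ a, a ∂(gaussianReal 0 (noiseVar σ))) * ∑ t, u t|}
  have hB := pi_weighted_sum_chebyshev μ hμ (fun t => u t * x t) (half_pos hτ)
  have hC := pi_weighted_sum_chebyshev (gaussianReal 0 (noiseVar σ))
    (memLp_id_gaussianReal' 2 (by simp)) u (half_pos hτ)
  have hsub : {p : (Fin n → ℝ) × (Fin n → ℝ) | (fun t => p.2 t + p.1 t * x t) ∈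
      {y : Fin n → ℝ | τ ≤ |∑ t, u t * y t - (∫ a, a ∂μ) * ∑ t, u t * x t|}} ⊆
      B ×ˢ Set.univ ∪ Set.univ ×ˢ C := by
    rintro ⟨h, z⟩ hp
    by_contra hcon
    simp only [Set.mem_union, Set.mem_prod, Set.mem_univ, and_true, true_and, not_or] at hcon
    obtain ⟨h1, h2⟩ := hcon
    simp only [B, C, Set.mem_ofPred_eq, not_le, integral_id_gaussianReal, zero_mul, sub_zero]
      at h1 h2 hp
    have e : ∑ t, u t * (z t + h t * x t) = ∑ t, u t * x t * h t + ∑ t, u t * z t := by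
      rw [← Finset.sum_add_distrib]
      exact Finset.sum_congr rfl fun t _ => by ring
    rw [e] at hp
    rw [abs_lt] at h1 h2
    rcases le_abs.1 hp with h | h <;> linarith [h1.1, h1.2, h2.1, h2.2]
  have hb0 : 0 ≤ (∑ t, (u t * x t) ^ 2) * Var[id; μ] / (τ / 2) ^ 2 :=
    div_nonneg (mul_nonneg (Finset.sum_nonneg fun _ _ => sq_nonneg _) (variance_nonneg _ _))
      (sq_nonneg _)
  have hc0 : 0 ≤ (∑ t, u t ^ 2) * Var[id; gaussianReal 0 (noiseVar σ)] / (τ / 2) ^ 2 :=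
    div_nonneg (mul_nonneg (Finset.sum_nonneg fun _ _ => sq_nonneg _) (variance_nonneg _ _))
      (sq_nonneg _)
  calc _ ≤ (P.prod Q) (B ×ˢ Set.univ ∪ Set.univ ×ˢ C) := measure_mono hsub
    _ ≤ (P.prod Q) (B ×ˢ Set.univ) + (P.prod Q) (Set.univ ×ˢ C) := measure_union_le _ _
    _ = P B + Q C := by simp [Measure.prod_prod]
    _ ≤ _ := add_le_add hB hC
    _ = _ := by
      rw [← ENNReal.ofReal_add hb0 hc0, variance_id_gaussianReal]
      congr 1
      have hv : ((noiseVar σ : ℝ≥0) : ℝ) = σ ^ 2 := rfl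
      rw [hv]
      field_simp
      ring

end FastFading
-- Codes with large Hamming distance and constant norm
namespace FastFading

/-- A word in the ball agrees with `x` off a set `T` of at most `m` positions: at most `2 ^ n`
choices of `T`, then at most `K ^ m` fillings. The crude `2 ^ n` is harmless against counts of order
`n^(cn)`. -/
lemma card_hammingBall_le {n K : ℕ} (hK : 0 < K) (m : ℕ) (x : Fin n → Fin K) :
    (Finset.univ.filter fun y : Fin n → Fin K => hammingDist y x ≤ m).card ≤ 2 ^ n * K ^ m := by
  classical
  let F : Finset (Fin n) → Finset (Fin n → Fin K) := fun T =>
    Fintype.piFinset fun t => if t ∈ T then Finset.univ else {x t}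
  have hF : ∀ T, (F T).card = K ^ T.card := by
    intro T
    simp [F, Fintype.card_piFinset, apply_ite Finset.card]
  have hsub : (Finset.univ.filter fun y : Fin n → Fin K => hammingDist y x ≤ m) ⊆
      (Finset.univ.filter fun T : Finset (Fin n) => T.card ≤ m).biUnion F := by
    intro y hy
    simp only [Finset.mem_filter, Finset.mem_univ, true_and] at hy
    refine Finset.mem_biUnion.2 ⟨Finset.univ.filter fun t => y t ≠ x t, ?_, ?_⟩
    · simpa [hammingDist] using hy
    · refine Fintype.mem_piFinset.2 fun t => ?_
      by_cases h : y t = x t <;> simp [h]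
  calc _ ≤ _ := Finset.card_le_card hsub
    _ ≤ (Finset.univ.filter fun T : Finset (Fin n) => T.card ≤ m).card * K ^ m := by
      refine Finset.card_biUnion_le_card_mul _ _ _ fun T hT => ?_
      rw [hF]
      exact Nat.pow_le_pow_right hK (Finset.mem_filter.1 hT).2
    _ ≤ 2 ^ n * K ^ m := by
      refine Nat.mul_le_mul_right _ ((Finset.card_le_univ _).trans ?_)
      simp

/-- Gilbert–Varshamov bound inside an arbitrary set `W` of words. -/
lemma exists_code_subset {n K : ℕ} (hK : 0 < K) (m : ℕ) (W : Finset (Fin n → Fin K)) :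
    ∃ S ⊆ W, (∀ x ∈ S, ∀ y ∈ S, x ≠ y → m < hammingDist x y) ∧
      W.card ≤ S.card * (2 ^ n * K ^ m) := by
  classical
  -- For a code of maximal size the balls of radius `m` cover `W`, since an uncovered word could be
  -- added.
  obtain ⟨S, hS, hmax⟩ := Finset.exists_max_image
    (W.powerset.filter fun S => ∀ x ∈ S, ∀ y ∈ S, x ≠ y → m < hammingDist x y)
    Finset.card ⟨∅, by simp⟩
  simp only [Finset.mem_filter, Finset.mem_powerset] at hS hmax
  refine ⟨S, hS.1, hS.2, ?_⟩
  have hcov : W ⊆ S.biUnion fun x =>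
      Finset.univ.filter fun y : Fin n → Fin K => hammingDist y x ≤ m := by
    intro y hy
    by_contra hcon
    simp only [Finset.mem_biUnion, Finset.mem_filter, Finset.mem_univ, true_and, not_exists,
      not_and, not_le] at hcon
    have hyS : y ∉ S := fun h => by simpa using hcon y h
    have := hmax (insert y S) ⟨Finset.insert_subset hy hS.1, ?_⟩
    · rw [Finset.card_insert_of_notMem hyS] at this
      omega
    · intro a ha b hb hab
      rcases Finset.mem_insert.1 ha with rfl | ha' <;>
        rcases Finset.mem_insert.1 hb with rfl | hb'
      · exact absurd rfl hab
      · exact hcon b hb'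
      · rw [hammingDist_comm]; exact hcon a ha'
      · exact hS.2 a ha' b hb' hab
  exact (Finset.card_le_card hcov).trans
    (Finset.card_biUnion_le_card_mul _ _ _ fun x _ => card_hammingBall_le hK m x)

/-- A large code of words with pairwise Hamming distance above `m` and equal sums of squares. -/
lemma exists_code_const_norm {n K : ℕ} (hK : 0 < K) (m : ℕ) :
    ∃ S : Finset (Fin n → Fin K), (∃ s : ℕ, ∀ x ∈ S, ∑ t, (x t : ℕ) ^ 2 = s) ∧
      (∀ x ∈ S, ∀ y ∈ S, x ≠ y → m < hammingDist x y) ∧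
      K ^ n ≤ (n * K ^ 2 + 1) * (S.card * (2 ^ n * K ^ m)) := by
  classical
  let f : (Fin n → Fin K) → ℕ := fun x => ∑ t, (x t : ℕ) ^ 2
  have hf : ∀ x ∈ (Finset.univ : Finset (Fin n → Fin K)), f x ∈ Finset.range (n * K ^ 2 + 1) := by
    intro x _
    rw [Finset.mem_range, Nat.lt_succ_iff]
    calc f x ≤ ∑ _t : Fin n, K ^ 2 :=
          Finset.sum_le_sum fun t _ => Nat.pow_le_pow_left (x t).2.le 2
      _ = n * K ^ 2 := by simp
  have hcard := Finset.card_eq_sum_card_fiberwise hf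
  -- Pigeonhole: `s` is a most frequent of the at most `n * K ^ 2 + 1` values of the sum of squares.
  obtain ⟨s, -, hmax⟩ := Finset.exists_max_image (Finset.range (n * K ^ 2 + 1))
    (fun s => (Finset.univ.filter fun x => f x = s).card) ⟨0, by simp⟩
  obtain ⟨S, hSW, hS, hle⟩ := exists_code_subset hK m (Finset.univ.filter fun x => f x = s)
  refine ⟨S, ⟨s, fun x hx => (Finset.mem_filter.1 (hSW hx)).2⟩, hS, ?_⟩
  calc K ^ n = (Finset.univ : Finset (Fin n → Fin K)).card := by simp
    _ ≤ (n * K ^ 2 + 1) * (Finset.univ.filter fun x => f x = s).card := by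
      rw [hcard]
      exact (Finset.sum_le_card_nsmul _ _ _ hmax).trans (by simp)
    _ ≤ _ := Nat.mul_le_mul_left _ hle

end FastFading

/-! ### The linear decoder -/

namespace FastFading

lemma outputProb_mono (μ : Measure ℝ) (σ : ℝ) {n : ℕ} (x : Fin n → ℝ) {D E : Set (Fin n → ℝ)}
    (h : D ⊆ E) : outputProb μ σ x D ≤ outputProb μ σ x E :=
  lintegral_mono fun _ => lintegral_mono_set h

/-- The error bound of the linear decoder for bounded codewords of equal norm. -/
lemma exists_DICode (μ : Measure ℝ) [IsProbabilityMeasure μ] (hμ : MemLp id 2 μ)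
    (ha : ∫ x, x ∂μ ≠ 0) {σ A : ℝ} (hσ : 0 < σ) (hA : 0 < A) {n K m M : ℕ} (hK : 0 < K)
    (hM : (n * K ^ 2 + 1) * (M * (2 ^ n * K ^ m)) ≤ K ^ n) {τ : ℝ} (hτ : 0 < τ)
    (hτK : τ ≤ |∫ x, x ∂μ| * A * (m + 1) / (4 * K ^ 2)) {l₁ l₂ : ℝ}
    (h₁ : 4 * n * (A ^ 2 * Var[id; μ] + A * σ ^ 2) / τ ^ 2 ≤ l₁)
    (h₂ : 4 * n * (A ^ 2 * Var[id; μ] + A * σ ^ 2) / τ ^ 2 ≤ l₂) :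
    ∃ c : DICode A M n, c.HasErrorsLE μ σ l₁ l₂ := by
  obtain ⟨S, ⟨s, hs⟩, hdist, hcard⟩ := exists_code_const_norm (n := n) hK m
  have hMS : M ≤ S.card := by
    have h := hM.trans hcard
    exact Nat.le_of_mul_le_mul_right (Nat.le_of_mul_le_mul_left h (Nat.succ_pos _)) (by positivity)
  let w : Fin M → Fin n → Fin K := fun i => (S.equivFin.symm (Fin.castLE hMS i) : Fin n → Fin K)
  have hwS : ∀ i, w i ∈ S := fun i => (S.equivFin.symm (Fin.castLE hMS i)).2
  have hwinj : Function.Injective w := fun i j hij =>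
    Fin.castLE_injective hMS (S.equivFin.symm.injective (Subtype.ext hij))
  have hK' : (0 : ℝ) < K := by exact_mod_cast hK
  -- Scaling every entry into `[0, √A]` gives the power constraint and also bounds the fading
  -- variance of the statistic.
  let u : Fin M → Fin n → ℝ := fun i t => √A * ((w i t : ℕ) : ℝ) / K
  have husq : ∀ i t, u i t ^ 2 = A / K ^ 2 * ((w i t : ℕ) : ℝ) ^ 2 := by
    intro i t
    simp only [u, div_pow, mul_pow, Real.sq_sqrt hA.le]
    ring
  have hule : ∀ i t, u i t ^ 2 ≤ A := by
    intro i t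
    rw [husq, div_mul_eq_mul_div, div_le_iff₀ (by positivity)]
    have : ((w i t : ℕ) : ℝ) ≤ K := by exact_mod_cast (w i t).2.le
    gcongr
  have hnorm : ∀ i, ∑ t, u i t ^ 2 = A / K ^ 2 * s := by
    intro i
    simp_rw [husq, ← Finset.mul_sum]
    rw [← hs _ (hwS i)]
    push_cast
    rfl
  have hsum : ∀ i, ∑ t, u i t ^ 2 ≤ n * A := fun i =>
    (Finset.sum_le_sum fun t _ => hule i t).trans (by simp)
  -- Distinct integer symbols differ by at least 1, so each differing coordinate adds at least `A /
  -- K ^ 2` to the squared distance; equal norms turn half that distance into the gap.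
  have hgap : ∀ i j, i ≠ j →
      A * (m + 1) / (2 * K ^ 2) ≤ ∑ t, u j t * u j t - ∑ t, u j t * u i t := by
    intro i j hij
    have hd := hdist _ (hwS i) _ (hwS j) (hwinj.ne hij)
    have h1 : A / K ^ 2 * (hammingDist (w i) (w j) : ℝ) ≤ ∑ t, (u i t - u j t) ^ 2 := by
      rw [hammingDist, Finset.card_filter]
      push_cast
      rw [Finset.mul_sum]
      refine Finset.sum_le_sum fun t _ => ?_
      have e : (u i t - u j t) ^ 2 =
          A / K ^ 2 * (((w i t : ℕ) : ℝ) - ((w j t : ℕ) : ℝ)) ^ 2 := by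
        have : u i t - u j t = √A * (((w i t : ℕ) : ℝ) - ((w j t : ℕ) : ℝ)) / K := by
          simp only [u]; ring
        rw [this, div_pow, mul_pow, Real.sq_sqrt hA.le]
        ring
      rw [e]
      refine mul_le_mul_of_nonneg_left ?_ (by positivity)
      split_ifs with h
      · have hne : ((w i t : ℕ) : ℤ) - ((w j t : ℕ) : ℤ) ≠ 0 := by
          intro h0
          exact h (Fin.ext (by omega))
        have h1 : (1 : ℤ) ≤ (((w i t : ℕ) : ℤ) - ((w j t : ℕ) : ℤ)) ^ 2 := by
          have := sq_pos_of_ne_zero hne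
          omega
        exact_mod_cast h1
      · positivity
    have h2 : ∑ t, (u i t - u j t) ^ 2 =
        2 * (∑ t, u j t * u j t - ∑ t, u j t * u i t) := by
      have h3 : ∑ t, (u i t - u j t) ^ 2 =
          ∑ t, u i t ^ 2 + ∑ t, u j t * u j t - 2 * ∑ t, u j t * u i t := by
        rw [Finset.mul_sum, ← Finset.sum_add_distrib, ← Finset.sum_sub_distrib]
        exact Finset.sum_congr rfl fun t _ => by ring
      have h4 : ∑ t, u j t * u j t = ∑ t, u i t ^ 2 := by
        simp_rw [← pow_two]
        rw [hnorm, hnorm]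
      rw [h3, ← h4]
      ring
    have h5 : ((m : ℝ) + 1) ≤ (hammingDist (w i) (w j) : ℝ) := by exact_mod_cast hd
    have h6 : A / K ^ 2 * ((m : ℝ) + 1) ≤ 2 * (∑ t, u j t * u j t - ∑ t, u j t * u i t) := by
      rw [← h2]
      exact (mul_le_mul_of_nonneg_left h5 (by positivity)).trans h1
    have e : A * (m + 1) / (2 * (K : ℝ) ^ 2) = A / K ^ 2 * ((m : ℝ) + 1) / 2 := by
      field_simp
    rw [e]
    linarith
  let D : Fin M → Set (Fin n → ℝ) := fun j =>
    {y | |∑ t, u j t * y t - (∫ a, a ∂μ) * ∑ t, u j t * u j t| < τ}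
  have hbound : ∀ i j, outputProb μ σ (u i)
      {y | τ ≤ |∑ t, u j t * y t - (∫ a, a ∂μ) * ∑ t, u j t * u i t|} ≤
      ENNReal.ofReal (4 * n * (A ^ 2 * Var[id; μ] + A * σ ^ 2) / τ ^ 2) := by
    intro i j
    refine (outputProb_linear_chebyshev μ hμ hσ (u i) (u j) hτ).trans (ENNReal.ofReal_le_ofReal ?_)
    have hV := variance_nonneg id μ
    have h1 : ∑ t, (u j t * u i t) ^ 2 ≤ n * A ^ 2 := by
      refine (Finset.sum_le_sum fun t _ => ?_ : _ ≤ ∑ _t : Fin n, A ^ 2).trans (by simp)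
      rw [mul_pow, pow_two A]
      exact mul_le_mul (hule j t) (hule i t) (sq_nonneg _) hA.le
    refine div_le_div_of_nonneg_right ?_ (sq_nonneg τ)
    have h2 := mul_le_mul_of_nonneg_right h1 hV
    have h3 := mul_le_mul_of_nonneg_right (hsum j) (sq_nonneg σ)
    linarith
  refine ⟨⟨u, D, hsum, fun j => measurableSet_lt (by fun_prop) measurable_const⟩, ?_, ?_⟩
  · intro i
    refine le_trans (outputProb_mono μ σ (u i) ?_) ((hbound i i).trans (ENNReal.ofReal_le_ofReal h₁))
    intro y hy
    have hy' : ¬ |∑ t, u i t * y t - (∫ a, a ∂μ) * ∑ t, u i t * u i t| < τ := hy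
    exact not_lt.1 hy'
  · intro i j hij
    refine le_trans (outputProb_mono μ σ (u i) ?_) ((hbound i j).trans (ENNReal.ofReal_le_ofReal h₂))
    intro y hy
    have hy' : |∑ t, u j t * y t - (∫ a, a ∂μ) * ∑ t, u j t * u j t| < τ := hy
    change τ ≤ |∑ t, u j t * y t - (∫ a, a ∂μ) * ∑ t, u j t * u i t|
    -- The two means are at least `2 * τ` apart, so a statistic within `τ` of one deviates by at
    -- least `τ` from the other.
    have h1 : 2 * τ ≤
        |(∫ a, a ∂μ) * (∑ t, u j t * u j t - ∑ t, u j t * u i t)| := by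
      rw [abs_mul]
      have h2 := mul_le_mul_of_nonneg_left ((hgap i j hij).trans (le_abs_self _))
        (abs_nonneg (∫ a, a ∂μ))
      refine le_trans ?_ h2
      calc 2 * τ ≤ 2 * (|∫ x, x ∂μ| * A * (m + 1) / (4 * K ^ 2)) := by linarith
        _ = _ := by field_simp; ring
    have h3 := abs_sub_abs_le_abs_sub
      ((∫ a, a ∂μ) * (∑ t, u j t * u j t - ∑ t, u j t * u i t))
      ((∫ a, a ∂μ) * ∑ t, u j t * u j t - ∑ t, u j t * y t)
    have e : (∫ a, a ∂μ) * (∑ t, u j t * u j t - ∑ t, u j t * u i t) -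
      ((∫ a, a ∂μ) * ∑ t, u j t * u j t - ∑ t, u j t * y t) =
      ∑ t, u j t * y t - (∫ a, a ∂μ) * ∑ t, u j t * u i t := by ring
    rw [e, abs_sub_comm ((∫ a, a ∂μ) * ∑ t, u j t * u j t)] at h3
    linarith

/-! ### Asymptotics of code size and error -/

/-- The code size required at rate `R` is available once the margin power of `n` is at least `64`. -/
lemma code_size_le {R γ ε : ℝ} (hR : 0 < R) (hγ : 0 < γ) (hγ' : γ ≤ 1 / 4) (hε : 0 < ε)
    (hε' : ε < 1) {n : ℕ} (hn : 1 ≤ n) (hlarge : 64 ≤ (n : ℝ) ^ (γ * (1 - ε) - R)) :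
    (n * ⌊(n : ℝ) ^ γ⌋₊ ^ 2 + 1) *
      (⌈(n : ℝ) ^ ((n : ℝ) * R)⌉₊ * (2 ^ n * ⌊(n : ℝ) ^ γ⌋₊ ^ ⌊ε * n⌋₊)) ≤
      ⌊(n : ℝ) ^ γ⌋₊ ^ n := by
  set K := ⌊(n : ℝ) ^ γ⌋₊ with hKdef
  set m := ⌊ε * n⌋₊ with hmdef
  set M := ⌈(n : ℝ) ^ ((n : ℝ) * R)⌉₊ with hMdef
  have hn1 : (1 : ℝ) ≤ n := by exact_mod_cast hn
  have hn0 : (0 : ℝ) < n := by linarith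
  have hx1 : (1 : ℝ) ≤ (n : ℝ) ^ γ := Real.one_le_rpow hn1 hγ.le
  have hK1 : 1 ≤ K := Nat.le_floor (by simpa using hx1)
  have hK1' : (1 : ℝ) ≤ K := by exact_mod_cast hK1
  have hKle : (K : ℝ) ≤ (n : ℝ) ^ γ := Nat.floor_le (by linarith)
  have hKge : (n : ℝ) ^ γ ≤ 2 * K := by
    have := (Nat.lt_floor_add_one ((n : ℝ) ^ γ)).le
    rw [← hKdef] at this
    linarith
  have hmle : (m : ℝ) ≤ ε * n := Nat.floor_le (by positivity)
  have hmn : m ≤ n := by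
    have : (m : ℝ) ≤ n := hmle.trans (by nlinarith)
    exact_mod_cast this
  have hMle : (M : ℝ) ≤ 2 * (n : ℝ) ^ ((n : ℝ) * R) := by
    have h1 : (1 : ℝ) ≤ (n : ℝ) ^ ((n : ℝ) * R) := Real.one_le_rpow hn1 (by positivity)
    have := (Nat.ceil_lt_add_one (a := (n : ℝ) ^ ((n : ℝ) * R)) (by linarith)).le
    rw [← hMdef] at this
    linarith
  have hn2 : (n : ℝ) ≤ 2 ^ n := by exact_mod_cast Nat.lt_two_pow_self.le
  have hKn : (K : ℝ) ^ 2 ≤ n := by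
    calc (K : ℝ) ^ 2 ≤ ((n : ℝ) ^ γ) ^ 2 := by gcongr
      _ = (n : ℝ) ^ (γ * 2) := by rw [← Real.rpow_mul_natCast hn0.le]; norm_num
      _ ≤ (n : ℝ) ^ (1 : ℝ) := Real.rpow_le_rpow_of_exponent_le hn1 (by linarith)
      _ = n := Real.rpow_one _
  have hpoly : (n : ℝ) * K ^ 2 + 1 ≤ 2 * 4 ^ n := by
    have h4 : (4 : ℝ) ^ n = 2 ^ n * 2 ^ n := by rw [← mul_pow]; norm_num
    have h5 : (n : ℝ) * K ^ 2 ≤ 2 ^ n * 2 ^ n :=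
      mul_le_mul hn2 (hKn.trans hn2) (by positivity) (by positivity)
    have h6 : (1 : ℝ) ≤ 4 ^ n := one_le_pow₀ (by norm_num)
    linarith
  -- The second `2 ^ n` pays for the floor in `K ≥ n^γ / 2`. The base `64 = 4 * 16` collects the
  -- losses: `16 ^ n` from the norm count and both powers of 2, and the constant 4, from the norm
  -- count and the rounding of `M`, is absorbed into `4 ^ n`.
  have hmain : ((n : ℝ) * K ^ 2 + 1) * M * 2 ^ n * 2 ^ n ≤ 2 ^ n * K ^ (n - m) := by
    calc ((n : ℝ) * K ^ 2 + 1) * M * 2 ^ n * 2 ^ n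
        ≤ (2 * 4 ^ n) * (2 * (n : ℝ) ^ ((n : ℝ) * R)) * 2 ^ n * 2 ^ n := by gcongr
      _ = 4 * 16 ^ n * (n : ℝ) ^ ((n : ℝ) * R) := by
        have : (16 : ℝ) ^ n = 4 ^ n * 2 ^ n * 2 ^ n := by
          rw [← mul_pow, ← mul_pow]; norm_num
        rw [this]; ring
      _ ≤ 4 ^ n * 16 ^ n * (n : ℝ) ^ ((n : ℝ) * R) := by
        have : (4 : ℝ) ≤ 4 ^ n := le_self_pow₀ (by norm_num) (by omega)
        gcongr
      _ = 64 ^ n * (n : ℝ) ^ ((n : ℝ) * R) := by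
        rw [← mul_pow]; norm_num
      _ ≤ ((n : ℝ) ^ (γ * (1 - ε) - R)) ^ n * (n : ℝ) ^ ((n : ℝ) * R) := by gcongr
      _ = (n : ℝ) ^ (γ * ((1 - ε) * n)) := by
        rw [← Real.rpow_mul_natCast hn0.le, ← Real.rpow_add hn0]
        congr 1; ring
      _ ≤ (n : ℝ) ^ (γ * ((n - m : ℕ) : ℝ)) := by
        refine Real.rpow_le_rpow_of_exponent_le hn1 (mul_le_mul_of_nonneg_left ?_ hγ.le)
        rw [Nat.cast_sub hmn]
        linarith
      _ = ((n : ℝ) ^ γ) ^ (n - m) := Real.rpow_mul_natCast hn0.le _ _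
      _ ≤ (2 * K) ^ (n - m) := by gcongr
      _ = 2 ^ (n - m) * K ^ (n - m) := mul_pow _ _ _
      _ ≤ 2 ^ n * K ^ (n - m) := by
        have : (2 : ℝ) ^ (n - m) ≤ 2 ^ n := pow_le_pow_right₀ (by norm_num) (Nat.sub_le _ _)
        gcongr
  have hmain' : ((n : ℝ) * K ^ 2 + 1) * M * 2 ^ n ≤ K ^ (n - m) := by
    rw [mul_comm _ ((2 : ℝ) ^ n)] at hmain
    exact le_of_mul_le_mul_left hmain (by positivity)
  have : ((n : ℝ) * K ^ 2 + 1) * (M * (2 ^ n * (K : ℝ) ^ m)) ≤ (K : ℝ) ^ n := by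
    calc ((n : ℝ) * K ^ 2 + 1) * (M * (2 ^ n * (K : ℝ) ^ m))
        = ((n : ℝ) * K ^ 2 + 1) * M * 2 ^ n * (K : ℝ) ^ m := by ring
      _ ≤ (K : ℝ) ^ (n - m) * (K : ℝ) ^ m := by gcongr
      _ = (K : ℝ) ^ n := by rw [← pow_add, Nat.sub_add_cancel hmn]
  exact_mod_cast this

/-- Every rate below `1/4` is achievable. -/
lemma isAchievable_of_lt (μ : Measure ℝ) [IsProbabilityMeasure μ] (hμ : MemLp id 2 μ)
    (ha : ∫ x, x ∂μ ≠ 0) {σ A R : ℝ} (hσ : 0 < σ) (hA : 0 < A) (hR : 0 < R) (hR' : R < 1 / 4) :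
    IsAchievable μ σ A R := by
  refine ⟨hR, fun l₁ l₂ hl₁ hl₂ => ?_⟩
  obtain ⟨γ, hRγ, hγ⟩ := exists_between hR'
  have hγ0 : 0 < γ := hR.trans hRγ
  -- As `γ < 1`, `ε < γ - R` gives `γ * ε < γ - R`, which makes the exponent in `hexp` positive.
  obtain ⟨ε, hε0, hεγ⟩ := exists_between (sub_pos.2 hRγ)
  have hε1 : ε < 1 := by linarith
  have hexp : 0 < γ * (1 - ε) - R := by nlinarith
  set a := ∫ x, x ∂μ with hadef
  set V := A ^ 2 * Var[id; μ] + A * σ ^ 2 with hV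
  have hV0 : 0 ≤ V := by
    have := variance_nonneg id μ
    positivity
  -- The threshold will be `τ = b * n / (n^γ)²`. Using `n^γ` in place of its floor is safe, as it
  -- only lowers `τ`, and it makes the error bound an exact multiple of `n^(4γ - 1)`, which tends to
  -- 0.
  set b := |a| * A * ε / 4 with hb
  have hb0 : 0 < b := by
    have := abs_pos.2 ha
    positivity
  have hcast : Tendsto (fun n : ℕ => (n : ℝ)) atTop atTop := tendsto_natCast_atTop_atTop
  have ev1 : ∀ᶠ n : ℕ in atTop, 64 ≤ (n : ℝ) ^ (γ * (1 - ε) - R) :=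
    ((tendsto_rpow_atTop hexp).comp hcast).eventually_ge_atTop 64
  have ev2 : ∀ᶠ n : ℕ in atTop, 4 * V / b ^ 2 * (n : ℝ) ^ (-(1 - 4 * γ)) < min l₁ l₂ := by
    have h1 : Tendsto (fun n : ℕ => 4 * V / b ^ 2 * (n : ℝ) ^ (-(1 - 4 * γ))) atTop (𝓝 0) := by
      simpa using ((tendsto_rpow_neg_atTop (by linarith : 0 < 1 - 4 * γ)).comp hcast).const_mul
        (4 * V / b ^ 2)
    exact h1.eventually_lt_const (lt_min hl₁ hl₂)
  obtain ⟨n₀, hn₀⟩ := eventually_atTop.1 (ev1.and (ev2.and (eventually_ge_atTop 1)))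
  refine ⟨n₀, fun n hn => ?_⟩
  obtain ⟨h1, h2, hn1⟩ := hn₀ n hn
  have hn1' : (1 : ℝ) ≤ n := by exact_mod_cast hn1
  have hn0 : (0 : ℝ) < n := by linarith
  have hx0 : (0 : ℝ) < (n : ℝ) ^ γ := Real.rpow_pos_of_pos hn0 _
  have hK : 0 < ⌊(n : ℝ) ^ γ⌋₊ := Nat.floor_pos.2 (Real.one_le_rpow hn1' hγ0.le)
  have hKle : ((⌊(n : ℝ) ^ γ⌋₊ : ℕ) : ℝ) ≤ (n : ℝ) ^ γ := Nat.floor_le hx0.le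
  have hK' : (0 : ℝ) < (⌊(n : ℝ) ^ γ⌋₊ : ℕ) := by exact_mod_cast hK
  have hsize := code_size_le hR hγ0 hγ.le hε0 hε1 hn1 h1
  have hτ : 0 < b * n / ((n : ℝ) ^ γ) ^ 2 := by positivity
  have hval : 4 * n * V / (b * n / ((n : ℝ) ^ γ) ^ 2) ^ 2 =
      4 * V / b ^ 2 * (n : ℝ) ^ (-(1 - 4 * γ)) := by
    have e : (n : ℝ) ^ (-(1 - 4 * γ)) = ((n : ℝ) ^ γ) ^ 4 / n := by
      rw [← Real.rpow_mul_natCast hn0.le, eq_div_iff hn0.ne', ← Real.rpow_add_one hn0.ne']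
      congr 1; push_cast; ring
    rw [e]
    field_simp
  refine exists_DICode μ hμ ha hσ hA hK hsize hτ ?_ ?_ ?_
  · have hm : ε * n ≤ (⌊ε * n⌋₊ : ℕ) + 1 := (Nat.lt_floor_add_one _).le
    calc b * n / ((n : ℝ) ^ γ) ^ 2 = |a| * A * (ε * n) / (4 * ((n : ℝ) ^ γ) ^ 2) := by
          rw [hb]; field_simp
      _ ≤ |a| * A * ((⌊ε * n⌋₊ : ℕ) + 1) / (4 * (⌊(n : ℝ) ^ γ⌋₊ : ℕ) ^ 2) := by
          gcongr
  · rw [hval]; exact h2.le.trans (min_le_left _ _)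
  · rw [hval]; exact h2.le.trans (min_le_right _ _)

end FastFading

/-! ### The capacity bound -/

theorem mainTheorem5 (μ : MeasureTheory.Measure ℝ) [MeasureTheory.IsProbabilityMeasure μ]
    (σ A : ℝ) (hσ : 0 < σ) (hA : 0 < A)
    (h_fourth : MeasureTheory.Integrable (fun x : ℝ => x ^ 4) μ)
    (h_mean : ∫ x, x ∂μ ≠ 0) :
    (1 / 4 : ENNReal) ≤ FastFading.capacityDI μ σ A := by
  have hμ : MemLp id 2 μ := by
    refine (memLp_two_iff_integrable_sq aestronglyMeasurable_id).2 ?_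
    refine ((integrable_const (1 : ℝ)).add h_fourth).mono' (by fun_prop) (ae_of_all _ fun x => ?_)
    simp only [id, Real.norm_eq_abs, abs_of_nonneg (sq_nonneg x), Pi.add_apply]
    -- Domination `x² ≤ 1 + x⁴`, from `(x² - 1)² ≥ 0`.
    nlinarith [sq_nonneg (x ^ 2 - 1), sq_nonneg (x ^ 2)]
  have hq : (1 / 4 : ENNReal) = ENNReal.ofReal (1 / 4) := by
    rw [ENNReal.ofReal_div_of_pos (by norm_num)]
    simp
  rw [hq]
  refine le_of_forall_lt fun c hc => ?_
  have hc' : c.toReal < 1 / 4 := (ENNReal.lt_ofReal_iff_toReal_lt hc.ne_top).1 hc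
  obtain ⟨R, hcR, hR⟩ := exists_between hc'
  have hR0 : 0 < R := ENNReal.toReal_nonneg.trans_lt hcR
  calc c < ENNReal.ofReal R := (ENNReal.lt_ofReal_iff_toReal_lt hc.ne_top).2 hcR
    _ ≤ _ := le_iSup₂_of_le R
      (FastFading.isAchievable_of_lt μ hμ h_mean hσ hA hR0 hR) le_rfl
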